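/- Let $(\xi_n)_{n\ge 1}$ be independent, symmetric, infinitely divisible real random variables defined on the same probability space $(\Omega,\mathcal F,\mathbb P)$, such that $$\mathbb E\big[e^{ih\xi_n}\big]=\exp\Big[-\int_{\mathbb R}\big(1-\cos(hy)\big)\,\nu_n(dy)\Big],\qquad h\in\mathbb R,\ n\ge 1,$$ where each $\nu_n$ is a Lévy measure on $\mathbb R$, i.e. a $\sigma$-finite Borel measure with $\nu_n(\{0\})=0$ and $\int_{\mathbb R}(1\wedge y^2)\,\nu_n(dy)<+\infty$. Then the following assertions are equivalent: (i) $\sum_{n\ge 1}\xi_n^2<+\infty$, $\mathbb P$-a.s.; (ii) $\sum_{n\ge 1}\int_{\mathbb R}(1\wedge y^2)\,\nu_n(dy)<+\infty$. -/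

import Mathlib

open MeasureTheory ProbabilityTheory

/-- A Lévy measure on the real line: a σ-finite Borel measure `ν` with `ν {0} = 0` and
`∫ (1 ∧ y²) ν(dy) < ∞`. -/
structure IsLevyMeasure (ν : Measure ℝ) : Prop where
  sigmaFinite : SigmaFinite ν
  measure_zero : ν {0} = 0
  lintegral_lt_top : ∫⁻ y, ENNReal.ofReal (min 1 (y ^ 2)) ∂ν < ⊤

/-- A measure `μ` on the real line is infinitely divisible if for every `m ≥ 1` it is the law of
a sum of `m` independent random variables with a common law `ρ`. -/
def IsInfinitelyDivisible (μ : Measure ℝ) : Prop :=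
  ∀ m : ℕ, 1 ≤ m → ∃ ρ : Measure ℝ, IsProbabilityMeasure ρ ∧
    μ = (Measure.pi (fun _ : Fin m => ρ)).map (fun x => ∑ i, x i)

/-!
The link between the two conditions is the standard Gaussian law `γ`. With
`F ν h = ∫ (1 - cos (h y)) ν(dy)`, averaging the characteristic function of `ξ` over `γ` gives
`E[exp(-ξ²/2)] = ∫ exp(-F ν h) γ(dh)` (`integral_exp_neg_sq_div_two_eq`).

On the probabilistic side, for independent `ξ n` the series `∑ (ξ n)²` converges almost surely if
and only if `∑ (1 - E[exp(-(ξ n)²/2)]) < ∞`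
(`ae_summable_sq_iff_summable_one_sub_integral_exp`): independence turns `E[exp(-S/2)]` into an
infinite product, and conversely Tonelli makes `∑ (1 - exp(-(ξ n)²/2))` finite almost surely.

On the analytic side, put `b = ∫ (1 ∧ y²) dν`. The quantity `∫ (1 - exp(-F ν h)) γ(dh)` is at most
`∫ F ν dγ = ∫ (1 - exp(-y²/2)) ν(dy) ≤ b`. For a lower bound, `∫ F ν dγ ≥ b / 3`, while
`F ν h ≤ 2 (1 + h²) b` bounds the second moment of `F ν` under `γ` by a multiple of `b²`; a
Cauchy–Schwarz argument then gives a lower bound of order `b / (1 + M b)` with `M` universal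
(`levyMass_le_mul_integral_one_sub_exp`). Hence the series of `1 - E[exp(-(ξ n)²/2)]` and of `b n`
converge simultaneously.
-/

theorem one_sub_cos_mul_le (h y : ℝ) :
    1 - Real.cos (h * y) ≤ 2 * (1 + h ^ 2) * min 1 (y ^ 2) := by
  rcases min_cases 1 (y ^ 2) with ⟨e, _⟩ | ⟨e, _⟩ <;> rw [e]
  · nlinarith [Real.neg_one_le_cos (h * y), sq_nonneg h]
  · nlinarith [Real.one_sub_sq_div_two_le_cos (x := h * y), sq_nonneg (h * y), sq_nonneg y]

theorem exp_neg_le_inv_one_add {x : ℝ} (hx : 0 ≤ x) : Real.exp (-x) ≤ (1 + x)⁻¹ := by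
  rw [Real.exp_neg]
  exact inv_anti₀ (by linarith) (by linarith [Real.add_one_le_exp x])

theorem min_one_div_three_le_one_sub_exp {x : ℝ} (hx : 0 ≤ x) :
    min 1 x / 3 ≤ 1 - Real.exp (-x / 2) := by
  have h1 : Real.exp (-x / 2) ≤ (1 + x / 2)⁻¹ := by
    rw [neg_div]
    exact exp_neg_le_inv_one_add (by positivity)
  have h2 : (1 + x / 2)⁻¹ ≤ 1 - min 1 x / 3 := by
    rw [inv_le_iff_one_le_mul₀ (by positivity)]
    rcases min_cases 1 x with ⟨e, _⟩ | ⟨e, _⟩ <;> rw [e] <;> nlinarith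
  linarith

theorem one_sub_exp_le_min_one {x : ℝ} (hx : 0 ≤ x) : 1 - Real.exp (-x / 2) ≤ min 1 x := by
  refine le_min (by linarith [Real.exp_pos (-x / 2)]) ?_
  linarith [Real.add_one_le_exp (-x / 2)]

/-- The family of parabolas whose upper envelope over `c` is `x / (1 + x)`; integrating it and
optimizing over `c` amounts to a Cauchy–Schwarz inequality. -/
theorem quadratic_le_one_sub_exp_neg {x : ℝ} (hx : 0 ≤ x) (c : ℝ) :
    (2 * c - c ^ 2) * x - c ^ 2 * x ^ 2 ≤ 1 - Real.exp (-x) := by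
  have h1 := exp_neg_le_inv_one_add hx
  have h2 : (1 + x)⁻¹ ≤ 1 - ((2 * c - c ^ 2) * x - c ^ 2 * x ^ 2) := by
    rw [inv_le_iff_one_le_mul₀ (by positivity)]
    nlinarith [mul_nonneg hx (sq_nonneg (c * (1 + x) - 1))]
  linarith

/-! ### Gaussian averages -/

theorem integral_cexp_mul_gaussianReal (y : ℝ) :
    ∫ h, Complex.exp (Complex.I * ((h * y : ℝ) : ℂ)) ∂(gaussianReal 0 1)
      = ((Real.exp (-y ^ 2 / 2) : ℝ) : ℂ) := by
  have h := charFun_gaussianReal (μ := 0) (v := 1) y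
  rw [charFun_apply_real] at h
  convert h using 1
  · congr 1
    ext x
    push_cast
    ring_nf
  · push_cast
    congr 1
    ring

theorem integrable_cexp_mul {α : Type*} [MeasurableSpace α] (μ : Measure α) [IsFiniteMeasure μ]
    {f : α → ℝ} (hf : Measurable f) :
    Integrable (fun x => Complex.exp (Complex.I * ((f x : ℝ) : ℂ))) μ := by
  refine Integrable.of_bound (C := 1) (by fun_prop) (.of_forall fun x => ?_)
  rw [mul_comm, Complex.norm_exp_ofReal_mul_I]

theorem integral_cos_mul_gaussianReal (y : ℝ) :
    ∫ h, Real.cos (h * y) ∂(gaussianReal 0 1) = Real.exp (-y ^ 2 / 2) := by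
  have h := congrArg Complex.re (integral_cexp_mul_gaussianReal y)
  rw [Complex.ofReal_re] at h
  rw [← h]
  have h2 := integral_re (𝕜 := ℂ)
    (integrable_cexp_mul (gaussianReal 0 1) (f := fun h => h * y) (by fun_prop))
  refine Eq.trans ?_ h2
  congr 1
  ext x
  rw [mul_comm Complex.I]
  exact (Complex.exp_ofReal_mul_I_re _).symm

theorem integrable_one_add_sq_gaussianReal :
    Integrable (fun h : ℝ => 2 * (1 + h ^ 2)) (gaussianReal 0 1) := by
  have h2 : Integrable (fun h : ℝ => h ^ 2) (gaussianReal 0 1) := by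
    simpa using (memLp_id_gaussianReal (μ := 0) (v := 1) 2).integrable_norm_pow (p := 2) (by simp)
  exact ((integrable_const 1).add h2).const_mul 2

theorem integrable_one_add_sq_sq_gaussianReal :
    Integrable (fun h : ℝ => (2 * (1 + h ^ 2)) ^ 2) (gaussianReal 0 1) := by
  have h2 : Integrable (fun h : ℝ => h ^ 2) (gaussianReal 0 1) := by
    simpa using (memLp_id_gaussianReal (μ := 0) (v := 1) 2).integrable_norm_pow (p := 2) (by simp)
  have h4 : Integrable (fun h : ℝ => h ^ 4) (gaussianReal 0 1) := by
    have := (memLp_id_gaussianReal (μ := 0) (v := 1) 4).integrable_norm_pow (p := 4) (by simp)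
    simpa [show ∀ x : ℝ, |x| ^ 4 = x ^ 4 from fun x => (by decide : Even 4).pow_abs x] using this
  refine (((integrable_const (4 : ℝ)).add (h2.const_mul 8)).add (h4.const_mul 4)).congr
    (.of_forall fun h => ?_)
  simp only [Pi.add_apply]
  ring

/-- Gaussian randomization: if `exp(-F)` is the characteristic function of `X`, its average over
the standard Gaussian law is `E[exp(-X²/2)]`. -/
theorem integral_exp_neg_sq_div_two_eq {Ω : Type*} [MeasurableSpace Ω] {P : Measure Ω}
    [IsProbabilityMeasure P] {X : Ω → ℝ} (hX : Measurable X) {F : ℝ → ℝ}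
    (hF : ∀ h : ℝ, ∫ ω, Complex.exp (Complex.I * ((h * X ω : ℝ) : ℂ)) ∂P
      = Complex.exp (-((F h : ℝ) : ℂ))) :
    ∫ ω, Real.exp (-X ω ^ 2 / 2) ∂P = ∫ h, Real.exp (-F h) ∂(gaussianReal 0 1) := by
  have hint : Integrable (Function.uncurry fun (ω : Ω) (h : ℝ) =>
      Complex.exp (Complex.I * ((h * X ω : ℝ) : ℂ))) (P.prod (gaussianReal 0 1)) :=
    integrable_cexp_mul (P.prod (gaussianReal 0 1)) (f := fun p => p.2 * X p.1) (by fun_prop)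
  have h := integral_integral_swap hint
  simp_rw [integral_cexp_mul_gaussianReal, hF] at h
  rw [← Complex.ofReal_inj, ← integral_complex_ofReal, ← integral_complex_ofReal, h]
  simp

/-! ### The Lévy exponent under the Gaussian law -/

/-- The exponent `h ↦ ∫ (1 - cos (h y)) ν(dy)` of the symmetric Lévy–Khintchine formula. -/
noncomputable def levyExponent (ν : Measure ℝ) (h : ℝ) : ℝ := ∫ y, (1 - Real.cos (h * y)) ∂ν

/-- The truncated second moment `∫ (1 ∧ y²) ν(dy)`, as a real number. -/
noncomputable def levyMass (ν : Measure ℝ) : ℝ := ∫ y, min 1 (y ^ 2) ∂ν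

theorem levyMass_nonneg (ν : Measure ℝ) : 0 ≤ levyMass ν :=
  integral_nonneg fun y => le_min zero_le_one (sq_nonneg y)

theorem levyExponent_nonneg (ν : Measure ℝ) (h : ℝ) : 0 ≤ levyExponent ν h :=
  integral_nonneg fun _ => sub_nonneg.2 (Real.cos_le_one _)

theorem measurable_levyExponent (ν : Measure ℝ) [SFinite ν] : Measurable (levyExponent ν) := by
  have h : StronglyMeasurable (Function.uncurry fun h y : ℝ => 1 - Real.cos (h * y)) :=
    Measurable.stronglyMeasurable (by unfold Function.uncurry; fun_prop)
  exact (h.integral_prod_right (ν := ν)).measurable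

namespace IsLevyMeasure

variable {ν : Measure ℝ}

theorem integrable_min_one_sq (hν : IsLevyMeasure ν) :
    Integrable (fun y : ℝ => min 1 (y ^ 2)) ν := by
  refine ⟨by fun_prop, ?_⟩
  rw [hasFiniteIntegral_iff_ofReal (.of_forall fun y => le_min zero_le_one (sq_nonneg y))]
  exact hν.lintegral_lt_top

theorem lintegral_eq_ofReal_levyMass (hν : IsLevyMeasure ν) :
    ∫⁻ y, ENNReal.ofReal (min 1 (y ^ 2)) ∂ν = ENNReal.ofReal (levyMass ν) :=
  (ofReal_integral_eq_lintegral_ofReal hν.integrable_min_one_sq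
    (.of_forall fun y => le_min zero_le_one (sq_nonneg y))).symm

theorem integrable_one_sub_cos_prod (hν : IsLevyMeasure ν) :
    Integrable (Function.uncurry fun h y : ℝ => 1 - Real.cos (h * y))
      ((gaussianReal 0 1).prod ν) := by
  have := hν.sigmaFinite
  refine (integrable_one_add_sq_gaussianReal.mul_prod hν.integrable_min_one_sq).mono'
    (Measurable.aestronglyMeasurable (by unfold Function.uncurry; fun_prop))
    (.of_forall fun p => ?_)
  rw [Real.norm_of_nonneg (by simpa [Function.uncurry] using Real.cos_le_one _)]
  exact one_sub_cos_mul_le p.1 p.2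

theorem levyExponent_le (hν : IsLevyMeasure ν) (h : ℝ) :
    levyExponent ν h ≤ 2 * (1 + h ^ 2) * levyMass ν := by
  rw [levyExponent, levyMass, ← integral_const_mul]
  exact integral_mono_of_nonneg (.of_forall fun y => sub_nonneg.2 (Real.cos_le_one _))
    (hν.integrable_min_one_sq.const_mul _) (.of_forall fun y => one_sub_cos_mul_le h y)

theorem integrable_levyExponent (hν : IsLevyMeasure ν) :
    Integrable (levyExponent ν) (gaussianReal 0 1) :=
  have := hν.sigmaFinite
  hν.integrable_one_sub_cos_prod.integral_prod_left

theorem integral_levyExponent (hν : IsLevyMeasure ν) :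
    ∫ h, levyExponent ν h ∂(gaussianReal 0 1) = ∫ y, (1 - Real.exp (-y ^ 2 / 2)) ∂ν := by
  have := hν.sigmaFinite
  simp only [levyExponent]
  rw [integral_integral_swap hν.integrable_one_sub_cos_prod]
  congr 1
  ext y
  rw [integral_sub (integrable_const _), integral_cos_mul_gaussianReal]
  · simp
  · exact Integrable.of_bound (C := 1) (by fun_prop)
      (.of_forall fun x => Real.abs_cos_le_one _)

theorem integral_levyExponent_le (hν : IsLevyMeasure ν) :
    ∫ h, levyExponent ν h ∂(gaussianReal 0 1) ≤ levyMass ν := by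
  rw [hν.integral_levyExponent]
  refine integral_mono_of_nonneg (.of_forall fun y => ?_) hν.integrable_min_one_sq
    (.of_forall fun y => one_sub_exp_le_min_one (sq_nonneg y))
  exact (by positivity : 0 ≤ min 1 (y ^ 2) / 3).trans
    (min_one_div_three_le_one_sub_exp (sq_nonneg y))

theorem levyMass_div_three_le (hν : IsLevyMeasure ν) :
    levyMass ν / 3 ≤ ∫ h, levyExponent ν h ∂(gaussianReal 0 1) := by
  rw [hν.integral_levyExponent, levyMass, ← integral_div]
  have hlow (y : ℝ) := min_one_div_three_le_one_sub_exp (sq_nonneg y)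
  have h0 (y : ℝ) : 0 ≤ 1 - Real.exp (-y ^ 2 / 2) :=
    (by positivity : 0 ≤ min 1 (y ^ 2) / 3).trans (hlow y)
  refine integral_mono_of_nonneg (.of_forall fun y => by positivity) ?_ (.of_forall hlow)
  refine hν.integrable_min_one_sq.mono' (by fun_prop) (.of_forall fun y => ?_)
  rw [Real.norm_of_nonneg (h0 y)]
  exact one_sub_exp_le_min_one (sq_nonneg y)

theorem levyExponent_sq_le (hν : IsLevyMeasure ν) (h : ℝ) :
    levyExponent ν h ^ 2 ≤ (2 * (1 + h ^ 2)) ^ 2 * levyMass ν ^ 2 := by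
  rw [← mul_pow]
  exact pow_le_pow_left₀ (levyExponent_nonneg ν h) (hν.levyExponent_le h) 2

theorem integrable_levyExponent_sq (hν : IsLevyMeasure ν) :
    Integrable (fun h => levyExponent ν h ^ 2) (gaussianReal 0 1) := by
  have := hν.sigmaFinite
  refine (integrable_one_add_sq_sq_gaussianReal.mul_const (levyMass ν ^ 2)).mono'
    ((measurable_levyExponent ν).pow_const 2).aestronglyMeasurable (.of_forall fun h => ?_)
  rw [Real.norm_of_nonneg (sq_nonneg _)]
  exact hν.levyExponent_sq_le h

theorem integral_levyExponent_sq_le (hν : IsLevyMeasure ν) :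
    ∫ h, levyExponent ν h ^ 2 ∂(gaussianReal 0 1)
      ≤ (∫ h, (2 * (1 + h ^ 2)) ^ 2 ∂(gaussianReal 0 1)) * levyMass ν ^ 2 := by
  rw [← integral_mul_const]
  exact integral_mono hν.integrable_levyExponent_sq
    (integrable_one_add_sq_sq_gaussianReal.mul_const _) hν.levyExponent_sq_le

theorem integrable_exp_neg_levyExponent (hν : IsLevyMeasure ν) :
    Integrable (fun h => Real.exp (-levyExponent ν h)) (gaussianReal 0 1) := by
  have := hν.sigmaFinite
  refine Integrable.of_bound (C := 1)
    (measurable_levyExponent ν).neg.exp.aestronglyMeasurable (.of_forall fun h => ?_)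
  rw [Real.norm_of_nonneg (Real.exp_nonneg _), Real.exp_le_one_iff]
  exact neg_nonpos.2 (levyExponent_nonneg ν h)

theorem one_sub_integral_exp_le_levyMass (hν : IsLevyMeasure ν) :
    1 - ∫ h, Real.exp (-levyExponent ν h) ∂(gaussianReal 0 1) ≤ levyMass ν := by
  have h1 : ∫ h, (1 - levyExponent ν h) ∂(gaussianReal 0 1)
      ≤ ∫ h, Real.exp (-levyExponent ν h) ∂(gaussianReal 0 1) :=
    integral_mono ((integrable_const _).sub hν.integrable_levyExponent)
      hν.integrable_exp_neg_levyExponent fun h => Real.one_sub_le_exp_neg _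
  rw [integral_sub (integrable_const _) hν.integrable_levyExponent] at h1
  simp only [integral_const, probReal_univ, smul_eq_mul, mul_one] at h1
  linarith [hν.integral_levyExponent_le]

/-- A reverse bound for `one_sub_integral_exp_le_levyMass` with a universal constant, up to the
factor `1 + M * levyMass ν` that accounts for the saturation of `1 - exp(-F)` at `1`. -/
theorem levyMass_le_mul_integral_one_sub_exp (hν : IsLevyMeasure ν) :
    levyMass ν ≤ 27 / 2 *
      (1 + (∫ h, (2 * (1 + h ^ 2)) ^ 2 ∂(gaussianReal 0 1)) * levyMass ν) *
      (1 - ∫ h, Real.exp (-levyExponent ν h) ∂(gaussianReal 0 1)) := by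
  have hsq := hν.integral_levyExponent_sq_le
  set M : ℝ := ∫ h, (2 * (1 + h ^ 2)) ^ 2 ∂(gaussianReal 0 1) with hM
  have hM0 : 0 ≤ M := integral_nonneg fun h => sq_nonneg _
  have hb := levyMass_nonneg ν
  have hlow := hν.levyMass_div_three_le
  set b := levyMass ν
  have hMb : 0 ≤ M * b := mul_nonneg hM0 hb
  -- The parameter that is optimal, up to a constant factor, in the integrated parabola.
  set c : ℝ := 1 / (3 * (1 + M * b)) with hc
  have hc0 : 0 < c := by positivity
  have hcM : c * (1 + M * b) = 1 / 3 := by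
    rw [hc]
    field_simp
  have hc3 : c ≤ 1 / 3 := by nlinarith
  have hint : ∫ h, ((2 * c - c ^ 2) * levyExponent ν h - c ^ 2 * levyExponent ν h ^ 2)
        ∂(gaussianReal 0 1)
      ≤ ∫ h, (1 - Real.exp (-levyExponent ν h)) ∂(gaussianReal 0 1) :=
    integral_mono
      ((hν.integrable_levyExponent.const_mul _).sub (hν.integrable_levyExponent_sq.const_mul _))
      ((integrable_const _).sub hν.integrable_exp_neg_levyExponent)
      fun h => quadratic_le_one_sub_exp_neg (levyExponent_nonneg ν h) c
  rw [integral_sub (hν.integrable_levyExponent.const_mul _)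
      (hν.integrable_levyExponent_sq.const_mul _), integral_const_mul, integral_const_mul,
    integral_sub (integrable_const _) hν.integrable_exp_neg_levyExponent] at hint
  simp only [integral_const, probReal_univ, smul_eq_mul, mul_one] at hint
  set a := 1 - ∫ h, Real.exp (-levyExponent ν h) ∂(gaussianReal 0 1)
  have h1 : (2 * c - c ^ 2) * (b / 3)
      ≤ (2 * c - c ^ 2) * ∫ h, levyExponent ν h ∂(gaussianReal 0 1) :=
    mul_le_mul_of_nonneg_left hlow (by nlinarith)
  have h2 := mul_le_mul_of_nonneg_left hsq (sq_nonneg c)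
  have h3 : c * (2 / 9 * b) ≤ a := by
    have e1 : c ^ 2 * (b / 3) ≤ c * (b / 9) := by nlinarith [mul_nonneg hc0.le hb]
    have e2 : c ^ 2 * (M * b ^ 2) ≤ c * (b / 3) := by
      have : c * (M * b) ≤ 1 / 3 := by nlinarith
      nlinarith [mul_le_mul_of_nonneg_left this (mul_nonneg hc0.le hb)]
    nlinarith
  have h4 := mul_le_mul_of_nonneg_left h3 (by positivity : 0 ≤ 1 + M * b)
  have h5 : (1 + M * b) * (c * (2 / 9 * b)) = 2 / 27 * b := by
    linear_combination (2 / 9 * b) * hcM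
  linarith

end IsLevyMeasure

theorem summable_one_sub_integral_exp_iff_summable_levyMass {ν : ℕ → Measure ℝ}
    (hν : ∀ n, IsLevyMeasure (ν n)) :
    Summable (fun n => 1 - ∫ h, Real.exp (-levyExponent (ν n) h) ∂(gaussianReal 0 1)) ↔
      Summable (fun n => levyMass (ν n)) := by
  have hnonneg (n : ℕ) :
      0 ≤ 1 - ∫ h, Real.exp (-levyExponent (ν n) h) ∂(gaussianReal 0 1) := by
    have h := integral_mono (hν n).integrable_exp_neg_levyExponent (integrable_const (1 : ℝ))
      fun h => Real.exp_le_one_iff.2 (neg_nonpos.2 (levyExponent_nonneg (ν n) h))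
    simpa using h
  refine ⟨fun hs => ?_, fun hs => Summable.of_nonneg_of_le hnonneg
    (fun n => (hν n).one_sub_integral_exp_le_levyMass) hs⟩
  have hkey (n : ℕ) := (hν n).levyMass_le_mul_integral_one_sub_exp
  set M : ℝ := ∫ h, (2 * (1 + h ^ 2)) ^ 2 ∂(gaussianReal 0 1)
  have hM : 0 ≤ M := integral_nonneg fun h => sq_nonneg _
  have hlim := hs.tendsto_atTop_zero.const_mul (27 / 2 * M)
  rw [mul_zero] at hlim
  refine Summable.of_norm_bounded_eventually_nat (hs.mul_left 27) ?_
  filter_upwards [hlim.eventually_lt_const (by norm_num : (0 : ℝ) < 1 / 2)] with n hn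
  have hb := levyMass_nonneg (ν n)
  rw [Real.norm_of_nonneg hb]
  nlinarith [hkey n, mul_le_mul_of_nonneg_right hn.le hb]

/-! ### Almost sure summability of independent squares -/

theorem integrable_exp_neg_sq_div_two {Ω : Type*} [MeasurableSpace Ω] {P : Measure Ω}
    [IsFiniteMeasure P] {X : Ω → ℝ} (hX : Measurable X) :
    Integrable (fun ω => Real.exp (-X ω ^ 2 / 2)) P := by
  refine Integrable.of_bound (C := 1) (by fun_prop) (.of_forall fun ω => ?_)
  rw [Real.norm_of_nonneg (Real.exp_nonneg _), Real.exp_le_one_iff]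
  linarith [sq_nonneg (X ω)]

theorem summable_of_summable_one_sub_exp {x : ℕ → ℝ} (hx : ∀ n, 0 ≤ x n)
    (hs : Summable fun n => 1 - Real.exp (-x n / 2)) : Summable x := by
  refine Summable.of_norm_bounded_eventually_nat (hs.mul_left 3) ?_
  filter_upwards [hs.tendsto_atTop_zero.eventually_lt_const (by norm_num : (0 : ℝ) < 1 / 3)]
    with n hn
  rw [Real.norm_of_nonneg (hx n)]
  have h := min_one_div_three_le_one_sub_exp (hx n)
  rcases min_cases 1 (x n) with ⟨e, _⟩ | ⟨e, _⟩ <;> rw [e] at h <;> linarith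

theorem ae_summable_sq_of_summable_one_sub_integral_exp {Ω : Type*} [MeasurableSpace Ω]
    {P : Measure Ω} [IsProbabilityMeasure P] {ξ : ℕ → Ω → ℝ} (hmeas : ∀ n, Measurable (ξ n))
    (hs : Summable fun n => 1 - ∫ ω, Real.exp (-ξ n ω ^ 2 / 2) ∂P) :
    ∀ᵐ ω ∂P, Summable fun n => ξ n ω ^ 2 := by
  have hnonneg (n : ℕ) (ω : Ω) : 0 ≤ 1 - Real.exp (-ξ n ω ^ 2 / 2) := by
    rw [sub_nonneg, Real.exp_le_one_iff]
    linarith [sq_nonneg (ξ n ω)]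
  have heq (n : ℕ) : ∫⁻ ω, ENNReal.ofReal (1 - Real.exp (-ξ n ω ^ 2 / 2)) ∂P
      = ENNReal.ofReal (1 - ∫ ω, Real.exp (-ξ n ω ^ 2 / 2) ∂P) := by
    rw [← ofReal_integral_eq_lintegral_ofReal
      (by simpa only [Pi.sub_def] using
        (integrable_const (1 : ℝ)).sub (integrable_exp_neg_sq_div_two (P := P) (hmeas n)))
      (.of_forall (hnonneg n)),
      integral_sub (integrable_const _) (integrable_exp_neg_sq_div_two (hmeas n))]
    simp
  have hfin : ∫⁻ ω, ∑' n, ENNReal.ofReal (1 - Real.exp (-ξ n ω ^ 2 / 2)) ∂P ≠ ⊤ := by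
    rw [lintegral_tsum fun n => by fun_prop]
    simp_rw [heq]
    exact hs.tsum_ofReal_ne_top
  filter_upwards [ae_lt_top (Measurable.tsum fun n => by fun_prop) hfin] with ω hω
  refine summable_of_summable_one_sub_exp (fun n => sq_nonneg _) ?_
  have h := ENNReal.summable_toReal hω.ne
  simpa only [ENNReal.toReal_ofReal (hnonneg _ ω)] using h

theorem summable_one_sub_integral_exp_of_ae_summable_sq {Ω : Type*} [MeasurableSpace Ω]
    {P : Measure Ω} [IsProbabilityMeasure P] {ξ : ℕ → Ω → ℝ} (hmeas : ∀ n, Measurable (ξ n))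
    (hindep : iIndepFun ξ P) (hs : ∀ᵐ ω ∂P, Summable fun n => ξ n ω ^ 2) :
    Summable fun n => 1 - ∫ ω, Real.exp (-ξ n ω ^ 2 / 2) ∂P := by
  have hnonneg (n : ℕ) : 0 ≤ 1 - ∫ ω, Real.exp (-ξ n ω ^ 2 / 2) ∂P := by
    have h := integral_mono (integrable_exp_neg_sq_div_two (P := P) (hmeas n))
      (integrable_const (1 : ℝ))
      fun ω => Real.exp_le_one_iff.2 (by linarith [sq_nonneg (ξ n ω)])
    simpa using h
  have hprod (N : ℕ) : ∫ ω, Real.exp (-(∑ n ∈ Finset.range N, ξ n ω ^ 2) / 2) ∂P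
      = ∏ n ∈ Finset.range N, ∫ ω, Real.exp (-ξ n ω ^ 2 / 2) ∂P := by
    have hind : iIndepFun (fun n ω => ξ n ω ^ 2) P :=
      hindep.comp (fun _ x => x ^ 2) fun _ => by fun_prop
    have h := hind.mgf_sum (t := -1 / 2) (fun n => by fun_prop) (Finset.range N)
    simp only [mgf, Finset.sum_apply] at h
    convert h using 4 <;> ring_nf
  have hSmeas : AEMeasurable (fun ω => ∑' n, ξ n ω ^ 2) P := by
    have hm : Measurable fun ω => (∑' n, ENNReal.ofReal (ξ n ω ^ 2)).toReal :=
      (Measurable.tsum fun n => by fun_prop).ennreal_toReal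
    refine ⟨_, hm, hs.mono fun ω hω => ?_⟩
    simp only
    rw [← ENNReal.ofReal_tsum_of_nonneg (fun n => sq_nonneg _) hω,
      ENNReal.toReal_ofReal (tsum_nonneg fun n => sq_nonneg _)]
  have hSint : Integrable (fun ω => Real.exp (-(∑' n, ξ n ω ^ 2) / 2)) P := by
    refine Integrable.of_bound (C := 1) (hSmeas.neg.div_const 2).exp.aestronglyMeasurable
      (.of_forall fun ω => ?_)
    rw [Real.norm_of_nonneg (Real.exp_nonneg _), Real.exp_le_one_iff]
    have h : 0 ≤ ∑' n, ξ n ω ^ 2 := tsum_nonneg fun n => sq_nonneg _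
    linarith
  have hpos : 0 < ∫ ω, Real.exp (-(∑' n, ξ n ω ^ 2) / 2) ∂P := integral_exp_pos hSint
  set c := ∫ ω, Real.exp (-(∑' n, ξ n ω ^ 2) / 2) ∂P
  have hle (N : ℕ) : c ≤ ∏ n ∈ Finset.range N, ∫ ω, Real.exp (-ξ n ω ^ 2 / 2) ∂P := by
    rw [← hprod N]
    refine integral_mono_ae hSint ?_ (hs.mono fun ω hω => ?_)
    · refine Integrable.of_bound (C := 1) (by fun_prop) (.of_forall fun ω => ?_)
      rw [Real.norm_of_nonneg (Real.exp_nonneg _), Real.exp_le_one_iff]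
      linarith [Finset.sum_nonneg fun n (_ : n ∈ Finset.range N) => sq_nonneg (ξ n ω)]
    · refine Real.exp_le_exp.2 ?_
      linarith [hω.sum_le_tsum (Finset.range N) fun n _ => sq_nonneg (ξ n ω)]
  refine summable_of_sum_range_le (c := -Real.log c) hnonneg fun N => ?_
  have h1 : ∏ n ∈ Finset.range N, ∫ ω, Real.exp (-ξ n ω ^ 2 / 2) ∂P
      ≤ Real.exp (-∑ n ∈ Finset.range N, (1 - ∫ ω, Real.exp (-ξ n ω ^ 2 / 2) ∂P)) := by
    rw [← Finset.sum_neg_distrib, Real.exp_sum]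
    refine Finset.prod_le_prod (fun n _ => integral_nonneg fun ω => Real.exp_nonneg _)
      fun n _ => ?_
    linarith [Real.one_sub_le_exp_neg (1 - ∫ ω, Real.exp (-ξ n ω ^ 2 / 2) ∂P)]
  have h2 := Real.log_le_log hpos ((hle N).trans h1)
  rw [Real.log_exp] at h2
  linarith

theorem ae_summable_sq_iff_summable_one_sub_integral_exp {Ω : Type*} [MeasurableSpace Ω]
    {P : Measure Ω} [IsProbabilityMeasure P] {ξ : ℕ → Ω → ℝ} (hmeas : ∀ n, Measurable (ξ n))
    (hindep : iIndepFun ξ P) :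
    (∀ᵐ ω ∂P, Summable fun n => ξ n ω ^ 2) ↔
      Summable fun n => 1 - ∫ ω, Real.exp (-ξ n ω ^ 2 / 2) ∂P :=
  ⟨summable_one_sub_integral_exp_of_ae_summable_sq hmeas hindep,
    ae_summable_sq_of_summable_one_sub_integral_exp hmeas⟩

theorem lemma2p3 {Ω : Type*} [MeasurableSpace Ω] (P : Measure Ω) [IsProbabilityMeasure P]
    (ξ : ℕ → Ω → ℝ) (ν : ℕ → Measure ℝ)
    (hmeas : ∀ n, Measurable (ξ n))
    (hindep : iIndepFun ξ P)
    (hsymm : ∀ n, P.map (fun ω => -ξ n ω) = P.map (ξ n))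
    (hdiv : ∀ n, IsInfinitelyDivisible (P.map (ξ n)))
    (hν : ∀ n, IsLevyMeasure (ν n))
    (hchar : ∀ (n : ℕ) (h : ℝ),
      ∫ ω, Complex.exp (Complex.I * ((h * ξ n ω : ℝ) : ℂ)) ∂P
        = Complex.exp (-((∫ y, (1 - Real.cos (h * y)) ∂(ν n) : ℝ) : ℂ))) :
    (∀ᵐ ω ∂P, Summable (fun n => ξ n ω ^ 2)) ↔
      ∑' n, ∫⁻ y, ENNReal.ofReal (min 1 (y ^ 2)) ∂(ν n) < ⊤ := by
  have hG (n : ℕ) : ∫ ω, Real.exp (-ξ n ω ^ 2 / 2) ∂P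
      = ∫ h, Real.exp (-levyExponent (ν n) h) ∂(gaussianReal 0 1) :=
    integral_exp_neg_sq_div_two_eq (hmeas n) (hchar n)
  rw [ae_summable_sq_iff_summable_one_sub_integral_exp hmeas hindep]
  simp_rw [hG, (hν _).lintegral_eq_ofReal_levyMass]
  rw [summable_one_sub_integral_exp_iff_summable_levyMass hν]
  refine ⟨fun hs => hs.tsum_ofReal_lt_top, fun hs => ?_⟩
  simpa only [ENNReal.toReal_ofReal (levyMass_nonneg _)] using ENNReal.summable_toReal hs.ne
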